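/- Let $V$ be a finite dimensional vector space over $\mathbb R$ or $\mathbb C$ with a non-degenerate symmetric bilinear form $(\,,)$. Let $[\,,]$ be the induced Poisson bracket on $\bigwedge V$, that is, the unique bilinear operation with $[x,y]=(x,y)$ for $x,y\in V$, with $[v,w_1w_2]=[v,w_1]w_2+(-1)^{|v||w_1|}w_1[v,w_2]$ and with $[v,w]=-(-1)^{|v||w|}[w,v]$ for homogeneous $v,w,w_1,w_2\in\bigwedge V$. A skew-symmetric $n$-ary algebra structure $\mu\in\bigwedge^nV^*\otimes V$, $n\ge 1$, is called invariant if $(b,\mu(a_1,\dots,a_n))=-(a_1,\mu(b,a_2,\dots,a_n))$ for all $a_i,b\in V$; an element $\tilde\mu\in\bigwedge^{n+1}V$ is said to correspond to $\mu$ if $\mu(a_1,\dots,a_n)=[a_1,[a_2,\dots[a_n,\tilde\mu]\dots]]$ for all $a_i\in V$. For $l,k\ge 1$, $L\in\bigwedge^lV^*\otimes V$ and $K\in\bigwedge^kV^*\otimes V$ put $$L[K](a_1,\dots,a_{l+k-1})=\sum_{(I,J)}(-1)^{(I,J)}\,L(K(a_{i_1},\dots,a_{i_k}),a_{j_1},\dots,a_{j_{l-1}}),$$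 where the sum is over all pairs of increasing multi-indices $I=(i_1<\dots<i_k)$, $J=(j_1<\dots<j_{l-1})$ whose entries together are $1,\dots,l+k-1$, and $(-1)^{(I,J)}$ is the sign of the permutation $(i_1,\dots,i_k,j_1,\dots,j_{l-1})$. The Nijenhuis--Richardson bracket of $L$ and $K$ is $[L,K]^{NR}=(-1)^{(l-1)(k-1)}L[K]-K[L]$. Let $L\in\bigwedge^lV^*\otimes V$ and $K\in\bigwedge^kV^*\otimes V$, $l,k\ge1$, be skew-symmetric invariant algebra structures. Then there are elements $\tilde L\in\bigwedge^{l+1}V$ and $\tilde K\in\bigwedge^{k+1}V$ that correspond to $L$ and $K$, and for all such $\tilde L,\tilde K$ and all $a_1,\dots,a_{l+k-1}\in V$, $$[a_1,[a_2,\dots[a_{l+k-1},[\tilde L,\tilde K]]\dots]]=-(-1)^{(k+1)(l+1)}\,[L,K]^{NR}(a_1,\dots,a_{l+k-1}).$$ -/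

import Mathlib

open scoped ExteriorAlgebra

namespace PoissonNR

section Definitions

variable {𝕜 V : Type*} [Field 𝕜] [AddCommGroup V] [Module 𝕜 V] [FiniteDimensional 𝕜 V]

/-- The Poisson bracket on the exterior algebra of `V` attached to a bilinear form `B`.
In terms of a basis `e i` of `V` it is
`[v, w] = ∑ i, involute (e i* ⌋ v) * (B (e i) ⌋ w)`, where `⌋` is contraction.
The lemmas `poissonBracket_ι_ι`, `poissonBracket_mul_right` and `poissonBracket_skew` below say
that, for symmetric `B`, it satisfies the three rules that define the Poisson superalgebra
structure of the exterior algebra; as `V` generates that algebra, it is the only bilinear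
operation that does. -/
noncomputable def poissonBracket (B : LinearMap.BilinForm 𝕜 V) :
    ExteriorAlgebra 𝕜 V →ₗ[𝕜] ExteriorAlgebra 𝕜 V →ₗ[𝕜] ExteriorAlgebra 𝕜 V :=
  ∑ i, (LinearMap.mul 𝕜 (ExteriorAlgebra 𝕜 V)).compl₁₂
    ((CliffordAlgebra.involute (Q := (0 : QuadraticForm 𝕜 V))).toLinearMap ∘ₗ
      CliffordAlgebra.contractLeft ((Module.finBasis 𝕜 V).coord i))
    (CliffordAlgebra.contractLeft (B (Module.finBasis 𝕜 V i)))

/-- The iterated bracket `[a₁, [a₂, … [aₙ, x] … ]]`. -/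
noncomputable def iterBracket (B : LinearMap.BilinForm 𝕜 V) :
    {n : ℕ} → (Fin n → V) → ExteriorAlgebra 𝕜 V → ExteriorAlgebra 𝕜 V
  | 0, _, x => x
  | _ + 1, a, x =>
      poissonBracket B (ExteriorAlgebra.ι 𝕜 (a 0)) (iterBracket B (fun i => a i.succ) x)

end Definitions

section Algebras

variable {𝕜 V : Type*} [Field 𝕜] [AddCommGroup V] [Module 𝕜 V]

/-- A skew-symmetric `(n+1)`-ary algebra structure is invariant with respect to `B` if
`(b, {a, c₁, …, cₙ}) = -(a, {b, c₁, …, cₙ})`. -/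
def IsInvariant (B : LinearMap.BilinForm 𝕜 V) {n : ℕ} (μ : V [⋀^Fin (n + 1)]→ₗ[𝕜] V) : Prop :=
  ∀ (a b : V) (c : Fin n → V), B b (μ (Fin.cons a c)) = -B a (μ (Fin.cons b c))

/-- `μt` lies in the `(n+1)`-st exterior power and
`μ(a₁, …, aₙ) = [a₁, [… [aₙ, μt] … ]]` for all `a₁, …, aₙ`. -/
def Corresponds [FiniteDimensional 𝕜 V] (B : LinearMap.BilinForm 𝕜 V) {n : ℕ}
    (μ : V [⋀^Fin n]→ₗ[𝕜] V) (μt : ExteriorAlgebra 𝕜 V) : Prop :=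
  μt ∈ ⋀[𝕜]^(n + 1) V ∧ ∀ a : Fin n → V, ExteriorAlgebra.ι 𝕜 (μ a) = iterBracket B a μt

/-- The permutations `σ` of `k + m` letters with `σ 0 < … < σ (k-1)` and
`σ k < … < σ (k+m-1)`. They are the pairs `(I, J)` of complementary increasing multi-indices with
`|I| = k` and `|J| = m`, written as the sequence `(I, J)`. -/
def IsUnshuffle {k m : ℕ} (σ : Equiv.Perm (Fin (k + m))) : Prop :=
  StrictMono (fun i : Fin k => σ (Fin.castAdd m i)) ∧
    StrictMono (fun j : Fin m => σ (Fin.natAdd k j))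

open Classical in
/-- `L[K](a) = ∑ (-1)^(I,J) L(K(a_I), a_J)`, where `L` has arity `m + 1`, `K` has arity `k`, and
the sum is over the complementary increasing multi-indices with `|I| = k`, `|J| = m`. -/
noncomputable def insertion {m k : ℕ} (L : V [⋀^Fin (m + 1)]→ₗ[𝕜] V) (K : V [⋀^Fin k]→ₗ[𝕜] V)
    (a : Fin (k + m) → V) : V :=
  ∑ σ : Equiv.Perm (Fin (k + m)) with IsUnshuffle σ,
    (Equiv.Perm.sign σ : ℤ) •
      L (Fin.cons (K fun i => a (σ (Fin.castAdd m i))) fun j => a (σ (Fin.natAdd k j)))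

/-- The Nijenhuis-Richardson bracket `(-1)^((l-1)(k-1)) L[K] - K[L]` of `L` of arity `l = p + 1`
and `K` of arity `k = q + 1`, as a function of `l + k - 1 = p + q + 1` arguments. -/
noncomputable def nrBracket {p q : ℕ} (L : V [⋀^Fin (p + 1)]→ₗ[𝕜] V)
    (K : V [⋀^Fin (q + 1)]→ₗ[𝕜] V) (a : Fin (p + q + 1) → V) : V :=
  (-1 : ℤ) ^ (p * q) • insertion L K (fun i => a (Fin.cast (by omega) i)) -
    insertion K L (fun i => a (Fin.cast (by omega) i))

end Algebras

section Rules

open CliffordAlgebra (involute contractLeft)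

variable {𝕜 V : Type*} [Field 𝕜] [AddCommGroup V] [Module 𝕜 V]

theorem ι_mul_eq_involute_mul_ι (x : V) (w : ExteriorAlgebra 𝕜 V) :
    ExteriorAlgebra.ι 𝕜 x * w = involute w * ExteriorAlgebra.ι 𝕜 x := by
  induction w using CliffordAlgebra.left_induction with
  | algebraMap r => rw [AlgHom.commutes, Algebra.commutes]
  | add a b ha hb => rw [mul_add, ha, hb, map_add, add_mul]
  | ι_mul w y h =>
    have hxy : ExteriorAlgebra.ι 𝕜 x * ExteriorAlgebra.ι 𝕜 y =
        -(ExteriorAlgebra.ι 𝕜 y * ExteriorAlgebra.ι 𝕜 x) :=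
      eq_neg_of_add_eq_zero_left (ExteriorAlgebra.ι_add_mul_swap x y)
    change ExteriorAlgebra.ι 𝕜 x * (ExteriorAlgebra.ι 𝕜 y * w) = _
    rw [← mul_assoc, hxy, neg_mul, mul_assoc, h, map_mul, CliffordAlgebra.involute_ι]
    simp only [neg_mul, mul_assoc]

theorem contractLeft_mul (d : Module.Dual 𝕜 V) (v w : ExteriorAlgebra 𝕜 V) :
    contractLeft d (v * w) = contractLeft d v * w + involute v * contractLeft d w := by
  induction v using CliffordAlgebra.left_induction with
  | algebraMap r =>
    rw [CliffordAlgebra.contractLeft_algebraMap_mul, CliffordAlgebra.contractLeft_algebraMap,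
      AlgHom.commutes, zero_mul, zero_add]
  | add a b ha hb => simp only [add_mul, map_add, ha, hb]; abel
  | ι_mul v y h =>
    rw [mul_assoc, CliffordAlgebra.contractLeft_ι_mul, h, CliffordAlgebra.contractLeft_ι_mul,
      map_mul, CliffordAlgebra.involute_ι, sub_mul, mul_add, smul_mul_assoc]
    simp only [neg_mul, mul_assoc]
    abel

theorem contractLeft_involute (d : Module.Dual 𝕜 V) (w : ExteriorAlgebra 𝕜 V) :
    contractLeft d (involute w) = -involute (contractLeft d w) := by
  induction w using CliffordAlgebra.left_induction with
  | algebraMap r => simp [CliffordAlgebra.contractLeft_algebraMap]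
  | add a b ha hb => simp only [map_add, ha, hb, neg_add]
  | ι_mul w y h =>
    rw [map_mul, CliffordAlgebra.involute_ι, neg_mul, map_neg, CliffordAlgebra.contractLeft_ι_mul,
      CliffordAlgebra.contractLeft_ι_mul, h, map_sub, map_smul, map_mul,
      CliffordAlgebra.involute_ι]
    simp

theorem involute_of_mem {q : ℕ} {w : ExteriorAlgebra 𝕜 V} (hw : w ∈ ⋀[𝕜]^q V) :
    involute w = (-1 : ℤ) ^ q • w := by
  induction hw using Submodule.pow_induction_on_left' with
  | algebraMap r => simp
  | add x y i hx hy hx' hy' => rw [map_add, hx', hy', smul_add]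
  | mem_mul m hm i x hx ih =>
    obtain ⟨y, rfl⟩ := hm
    have h : involute (ExteriorAlgebra.ι 𝕜 y) = -ExteriorAlgebra.ι 𝕜 y :=
      CliffordAlgebra.involute_ι y
    rw [map_mul, ih, pow_succ, h, mul_smul_comm, neg_mul, mul_neg_one, neg_smul, smul_neg]

theorem mul_comm_of_mem {p q : ℕ} {v w : ExteriorAlgebra 𝕜 V} (hv : v ∈ ⋀[𝕜]^p V)
    (hw : involute w = (-1 : ℤ) ^ q • w) : v * w = (-1 : ℤ) ^ (p * q) • (w * v) := by
  induction hv using Submodule.pow_induction_on_left' with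
  | algebraMap r => simp [Algebra.commutes]
  | add x y i hx hy hx' hy' => rw [add_mul, hx', hy', mul_add, smul_add]
  | mem_mul m hm i x hx ih =>
    obtain ⟨y, rfl⟩ := hm
    rw [mul_assoc, ih, mul_smul_comm, ← mul_assoc, ι_mul_eq_involute_mul_ι, hw, Nat.succ_mul,
      pow_add, mul_smul, smul_mul_assoc, smul_mul_assoc, mul_assoc]

variable [FiniteDimensional 𝕜 V] (B : LinearMap.BilinForm 𝕜 V)

theorem poissonBracket_apply (v w : ExteriorAlgebra 𝕜 V) :
    poissonBracket B v w = ∑ i, involute (contractLeft ((Module.finBasis 𝕜 V).coord i) v) *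
      contractLeft (B (Module.finBasis 𝕜 V i)) w := by
  simp [poissonBracket, LinearMap.sum_apply]

theorem sum_coord_smul_contractLeft (x : V) (w : ExteriorAlgebra 𝕜 V) :
    ∑ i, (Module.finBasis 𝕜 V).coord i x •
      contractLeft (Q := (0 : QuadraticForm 𝕜 V)) (B (Module.finBasis 𝕜 V i)) w =
        contractLeft (B x) w := by
  conv_rhs => rw [← (Module.finBasis 𝕜 V).sum_repr x]
  simp only [map_sum, map_smul, LinearMap.sum_apply, LinearMap.smul_apply, Module.Basis.coord_apply]

theorem poissonBracket_algebraMap_left (r : 𝕜) (w : ExteriorAlgebra 𝕜 V) :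
    poissonBracket B (algebraMap 𝕜 _ r) w = 0 := by
  rw [poissonBracket_apply]
  exact Finset.sum_eq_zero fun i _ => by
    rw [CliffordAlgebra.contractLeft_algebraMap, map_zero, zero_mul]

theorem poissonBracket_ι_mul_left (x : V) (v w : ExteriorAlgebra 𝕜 V) :
    poissonBracket B (ExteriorAlgebra.ι 𝕜 x * v) w =
      ExteriorAlgebra.ι 𝕜 x * poissonBracket B v w + involute v * contractLeft (B x) w := by
  have h (i) : involute (contractLeft ((Module.finBasis 𝕜 V).coord i)
      (ExteriorAlgebra.ι 𝕜 x * v)) =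
      ExteriorAlgebra.ι 𝕜 x * involute (contractLeft ((Module.finBasis 𝕜 V).coord i) v) +
        (Module.finBasis 𝕜 V).coord i x • involute v := by
    have h' : involute (ExteriorAlgebra.ι 𝕜 x) = -ExteriorAlgebra.ι 𝕜 x :=
      CliffordAlgebra.involute_ι x
    have h'' := CliffordAlgebra.contractLeft_ι_mul (Q := (0 : QuadraticForm 𝕜 V))
      (d := (Module.finBasis 𝕜 V).coord i) x v
    change contractLeft _ (ExteriorAlgebra.ι 𝕜 x * v) =
      _ - ExteriorAlgebra.ι 𝕜 x * contractLeft _ v at h''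
    rw [h'', map_sub, map_smul, map_mul, h', neg_mul, sub_neg_eq_add, add_comm]
  rw [poissonBracket_apply, poissonBracket_apply, Finset.mul_sum,
    ← sum_coord_smul_contractLeft B x w, Finset.mul_sum, ← Finset.sum_add_distrib]
  refine Finset.sum_congr rfl fun i _ => ?_
  rw [h, add_mul, mul_assoc, smul_mul_assoc, mul_smul_comm]

theorem poissonBracket_ι_left (x : V) (w : ExteriorAlgebra 𝕜 V) :
    poissonBracket B (ExteriorAlgebra.ι 𝕜 x) w = contractLeft (B x) w := by
  have h := poissonBracket_ι_mul_left B x (algebraMap 𝕜 _ 1) w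
  rw [poissonBracket_algebraMap_left] at h
  simpa using h

/-- `[x, y] = (x, y)` for `x, y` in `V`. -/
theorem poissonBracket_ι_ι (x y : V) :
    poissonBracket B (ExteriorAlgebra.ι 𝕜 x) (ExteriorAlgebra.ι 𝕜 y) =
      algebraMap 𝕜 (ExteriorAlgebra 𝕜 V) (B x y) := by
  rw [poissonBracket_ι_left]
  exact CliffordAlgebra.contractLeft_ι (Q := (0 : QuadraticForm 𝕜 V)) (B x) y

/-- `[v, w₁ w₂] = [v, w₁] w₂ + (-1)^(v w₁) w₁ [v, w₂]` for homogeneous elements. -/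
theorem poissonBracket_mul_right {p q : ℕ} {v w₁ : ExteriorAlgebra 𝕜 V} (hv : v ∈ ⋀[𝕜]^p V)
    (hw : w₁ ∈ ⋀[𝕜]^q V) (w₂ : ExteriorAlgebra 𝕜 V) :
    poissonBracket B v (w₁ * w₂) =
      poissonBracket B v w₁ * w₂ + (-1 : ℤ) ^ (p * q) • (w₁ * poissonBracket B v w₂) := by
  induction hv using Submodule.pow_induction_on_left' with
  | algebraMap r => simp [poissonBracket_algebraMap_left]
  | add x y i hx hy hx' hy' =>
    rw [map_add, LinearMap.add_apply, hx', hy', LinearMap.add_apply, LinearMap.add_apply, add_mul,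
      mul_add, smul_add]
    abel
  | mem_mul m hm i v hx ih =>
    obtain ⟨x, rfl⟩ := hm
    have h1 := involute_of_mem hw
    have h2 := mul_comm_of_mem (v := v) hx h1
    have h3 : involute v * involute w₁ = (-1 : ℤ) ^ (i * q) • (involute w₁ * involute v) := by
      rw [← map_mul, h2, map_zsmul, map_mul]
    have h5 : ExteriorAlgebra.ι 𝕜 x * w₁ = (-1 : ℤ) ^ q • (w₁ * ExteriorAlgebra.ι 𝕜 x) := by
      rw [ι_mul_eq_involute_mul_ι, h1, smul_mul_assoc]
    have h6 : involute v * involute w₁ = (-1 : ℤ) ^ ((i + 1) * q) • (w₁ * involute v) := by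
      rw [h3, h1, smul_mul_assoc, smul_smul, ← pow_add, Nat.succ_mul]
    have h7 : ExteriorAlgebra.ι 𝕜 x * ((-1 : ℤ) ^ (i * q) • (w₁ * poissonBracket B v w₂)) =
        (-1 : ℤ) ^ ((i + 1) * q) • (w₁ * (ExteriorAlgebra.ι 𝕜 x * poissonBracket B v w₂)) := by
      rw [mul_smul_comm, ← mul_assoc, h5, smul_mul_assoc, smul_smul, ← pow_add, Nat.succ_mul,
        mul_assoc]
    rw [poissonBracket_ι_mul_left, poissonBracket_ι_mul_left, poissonBracket_ι_mul_left, ih,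
      contractLeft_mul, mul_add, mul_add, h7, ← mul_assoc (involute v) (involute w₁), h6, add_mul,
      mul_add w₁, smul_add, smul_mul_assoc]
    simp only [mul_assoc, add_mul]
    abel

/-- `[v, w] = -(-1)^(v w) [w, v]` for homogeneous elements. -/
theorem poissonBracket_skew (hB : B.IsSymm) {p q : ℕ} {v w : ExteriorAlgebra 𝕜 V}
    (hv : v ∈ ⋀[𝕜]^p V) (hw : w ∈ ⋀[𝕜]^q V) :
    poissonBracket B v w = -((-1 : ℤ) ^ (p * q) • poissonBracket B w v) := by
  have hinv := involute_of_mem hw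
  have hι (x : V) : poissonBracket B w (ExteriorAlgebra.ι 𝕜 x) =
      -((-1 : ℤ) ^ q • contractLeft (B x) w) := by
    have h0 : poissonBracket B w (ExteriorAlgebra.ι 𝕜 x) = involute (contractLeft (B x) w) := by
      have hBx : B x = ∑ i, B x (Module.finBasis 𝕜 V i) • (Module.finBasis 𝕜 V).coord i :=
        ((Module.finBasis 𝕜 V).sum_dual_apply_smul_coord (B x)).symm
      rw [poissonBracket_apply]
      conv_rhs => rw [hBx]
      simp only [map_sum, map_smul, LinearMap.sum_apply, LinearMap.smul_apply]
      refine Finset.sum_congr rfl fun i _ => ?_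
      have h : contractLeft (B (Module.finBasis 𝕜 V i)) (ExteriorAlgebra.ι 𝕜 x) =
          algebraMap 𝕜 (ExteriorAlgebra 𝕜 V) (B (Module.finBasis 𝕜 V i) x) :=
        CliffordAlgebra.contractLeft_ι (Q := (0 : QuadraticForm 𝕜 V)) _ x
      rw [h, ← Algebra.commutes, ← Algebra.smul_def, hB.eq]
    rw [h0, ← neg_eq_iff_eq_neg, ← contractLeft_involute, hinv, map_zsmul]
  induction hv using Submodule.pow_induction_on_left' with
  | algebraMap r =>
    rw [poissonBracket_algebraMap_left, poissonBracket_apply]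
    simp [CliffordAlgebra.contractLeft_algebraMap]
  | add x y i hx hy hx' hy' =>
    rw [map_add, LinearMap.add_apply, hx', hy', map_add, smul_add, neg_add]
  | mem_mul m hm i v hx ih =>
    obtain ⟨x, rfl⟩ := hm
    have hx1 : ExteriorAlgebra.ι 𝕜 x ∈ ⋀[𝕜]^1 V := by simp
    have h1 : involute (contractLeft (B x) w) = (-1 : ℤ) ^ (q + 1) • contractLeft (B x) w := by
      rw [← neg_eq_iff_eq_neg.mpr (contractLeft_involute (B x) w), hinv, map_zsmul, pow_succ,
        mul_neg_one, neg_smul]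
    have h2 := involute_of_mem hx
    have h3 := mul_comm_of_mem hx h1
    rw [poissonBracket_mul_right B hw hx1, poissonBracket_ι_mul_left, hι, ih, h2,
      smul_mul_assoc, h3, neg_mul, smul_mul_assoc]
    simp only [smul_add, smul_neg, mul_neg, mul_smul_comm, smul_smul, neg_add, neg_neg, ← pow_add]
    have e1 : (-1 : ℤ) ^ (i + i * (q + 1)) = (-1) ^ (i.succ * q + q) := by
      rw [neg_one_pow_congr]; simp only [Nat.succ_eq_add_one]; grind
    have e2 : (-1 : ℤ) ^ (i * q) = (-1) ^ (i.succ * q + q * 1) := by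
      rw [neg_one_pow_congr]; simp only [Nat.succ_eq_add_one]; grind
    rw [e1, e2, add_comm]

end Rules

end PoissonNR

/-!
Bracketing with a vector `c` is the contraction `D c` with the linear form `B c`. These contractions
anticommute, and they are odd derivations both of the product and of the Poisson bracket
(`contractLeft_poissonBracket`). The theorem has two halves.

Existence of a corresponding element is an integration problem. Euler's formula
`∑ eᵢ ∧ (eᵢ* ⌋ w) = n w` for `w` of degree `n` (`sum_ι_mul_contractLeft_coord`) shows, in
characteristic zero, that an element of positive degree is determined by its contractions. It also
gives a Poincaré lemma (`contractLeft_radialPrimitive`): a linear family `T` of elements of degree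
`n` has the form `T c = D c t` as soon as `D c (T d) = -D d (T c)`. Integrating one argument at a
time, every alternating form is an iterated bracket (`exists_linearMap_iterBracket_eq`), and one
more integration, for which invariance is precisely the condition required, handles an invariant
algebra structure (`exists_corresponds`).

For the formula, the Leibniz rule expands `D a₁ ⋯ D aₙ [v, w]` as a signed sum over the subsets of
the indices, namely of those `i` for which `D aᵢ` acts on `v` (`iterBracket_poissonBracket`). Scalars
have zero bracket, so for `v` and `w` of degrees `l + 1` and `k + 1`, and `n = l + k - 1`, the only
terms left are those in which either `l` contractions act on `v` and `k - 1` on `w`, or `l - 1` on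
`v` and `k` on `w` (`iterBracket_poissonBracket_eq_add`). The former are the terms of `K[L]`, the
latter those of `-L[K]`. Subsets correspond to unshuffles (`sum_isUnshuffle_headSet`), and the sign
of an unshuffle counts the pairs of indices that cross (`crossingSign_headSet`).
-/

namespace PoissonNR

open CliffordAlgebra (involute contractLeft)

/-! ### Contractions and the grading -/

section Contraction

variable {𝕜 V : Type*} [Field 𝕜] [AddCommGroup V] [Module 𝕜 V]

theorem contractLeft_ι_mul (d : Module.Dual 𝕜 V) (y : V) (x : ExteriorAlgebra 𝕜 V) :
    contractLeft d (ExteriorAlgebra.ι 𝕜 y * x) =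
      d y • x - ExteriorAlgebra.ι 𝕜 y * contractLeft d x :=
  CliffordAlgebra.contractLeft_ι_mul (Q := (0 : QuadraticForm 𝕜 V)) (d := d) y x

theorem ι_mul_mem (y : V) {n : ℕ} {x : ExteriorAlgebra 𝕜 V} (hx : x ∈ ⋀[𝕜]^n V) :
    ExteriorAlgebra.ι 𝕜 y * x ∈ ⋀[𝕜]^(n + 1) V := by
  change _ ∈ (LinearMap.range (ExteriorAlgebra.ι 𝕜 : V →ₗ[𝕜] _)) ^ (n + 1)
  rw [pow_succ']
  exact Submodule.mul_mem_mul ⟨y, rfl⟩ hx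

theorem mem_exteriorPower_zero {x : ExteriorAlgebra 𝕜 V} :
    x ∈ ⋀[𝕜]^0 V ↔ ∃ r, algebraMap 𝕜 _ r = x := by
  change x ∈ (LinearMap.range (ExteriorAlgebra.ι 𝕜 : V →ₗ[𝕜] _)) ^ 0 ↔ _
  rw [pow_zero, Submodule.mem_one]

theorem contractLeft_eq_zero_of_mem (d : Module.Dual 𝕜 V) {x : ExteriorAlgebra 𝕜 V}
    (hx : x ∈ ⋀[𝕜]^0 V) : contractLeft d x = 0 := by
  obtain ⟨r, rfl⟩ := mem_exteriorPower_zero.1 hx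
  exact CliffordAlgebra.contractLeft_algebraMap ..

/-- Contraction lowers the degree by one. In degree `0`, where the subtraction truncates, it
vanishes, so the statement holds there too. -/
theorem contractLeft_mem (d : Module.Dual 𝕜 V) {n : ℕ} {x : ExteriorAlgebra 𝕜 V}
    (hx : x ∈ ⋀[𝕜]^n V) : contractLeft d x ∈ ⋀[𝕜]^(n - 1) V := by
  induction hx using Submodule.pow_induction_on_left' with
  | algebraMap r => rw [CliffordAlgebra.contractLeft_algebraMap]; exact Submodule.zero_mem _
  | add x y i hx hy hx' hy' => rw [map_add]; exact Submodule.add_mem _ hx' hy'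
  | mem_mul m hm i x hx ih =>
    obtain ⟨y, rfl⟩ := hm
    rw [contractLeft_ι_mul]
    refine Submodule.sub_mem _ (Submodule.smul_mem _ _ hx) ?_
    cases i with
    | zero =>
      rw [contractLeft_eq_zero_of_mem d hx, mul_zero]
      exact Submodule.zero_mem _
    | succ i => exact ι_mul_mem y ih

/-- Euler's formula: `∑ eᵢ ∧ (eᵢ* ⌋ w) = n w` for `w` of degree `n`. -/
theorem sum_ι_mul_contractLeft_coord {κ : Type*} [Fintype κ] (b : Module.Basis κ 𝕜 V) {n : ℕ}
    {w : ExteriorAlgebra 𝕜 V} (hw : w ∈ ⋀[𝕜]^n V) :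
    ∑ i, ExteriorAlgebra.ι 𝕜 (b i) * contractLeft (b.coord i) w = (n : 𝕜) • w := by
  induction hw using Submodule.pow_induction_on_left' with
  | algebraMap r => simp [CliffordAlgebra.contractLeft_algebraMap]
  | add x y i hx hy hx' hy' =>
    simp only [map_add, mul_add, Finset.sum_add_distrib, hx', hy', smul_add]
  | mem_mul m hm i x hx ih =>
    obtain ⟨y, rfl⟩ := hm
    have h (j) : ExteriorAlgebra.ι 𝕜 (b j) *
        contractLeft (b.coord j) (ExteriorAlgebra.ι 𝕜 y * x) =
        b.repr y j • (ExteriorAlgebra.ι 𝕜 (b j) * x) +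
          ExteriorAlgebra.ι 𝕜 y * (ExteriorAlgebra.ι 𝕜 (b j) * contractLeft (b.coord j) x) := by
      have hxy : ExteriorAlgebra.ι 𝕜 (b j) * ExteriorAlgebra.ι 𝕜 y =
          -(ExteriorAlgebra.ι 𝕜 y * ExteriorAlgebra.ι 𝕜 (b j)) :=
        eq_neg_of_add_eq_zero_left (ExteriorAlgebra.ι_add_mul_swap _ _)
      rw [contractLeft_ι_mul, mul_sub, mul_smul_comm, ← mul_assoc, hxy, neg_mul, sub_neg_eq_add,
        mul_assoc, Module.Basis.coord_apply]
    simp only [h, Finset.sum_add_distrib, ← Finset.mul_sum, ih]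
    have hy : ∑ j, b.repr y j • (ExteriorAlgebra.ι 𝕜 (b j) * x) = ExteriorAlgebra.ι 𝕜 y * x := by
      conv_rhs => rw [← b.sum_repr y]
      simp only [map_sum, map_smul, Finset.sum_mul, smul_mul_assoc]
    rw [hy, mul_smul_comm, Nat.succ_eq_add_one, Nat.cast_succ, add_smul, one_smul, add_comm]

theorem eq_zero_of_forall_contractLeft_eq_zero [CharZero 𝕜] [FiniteDimensional 𝕜 V] {n : ℕ}
    {w : ExteriorAlgebra 𝕜 V} (hw : w ∈ ⋀[𝕜]^(n + 1) V)
    (h : ∀ d : Module.Dual 𝕜 V, contractLeft d w = 0) : w = 0 := by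
  have := sum_ι_mul_contractLeft_coord (Module.finBasis 𝕜 V) hw
  simp only [h, mul_zero, Finset.sum_const_zero] at this
  exact (smul_eq_zero.1 this.symm).resolve_left (Nat.cast_ne_zero.2 n.succ_ne_zero)

end Contraction

/-! ### Iterated brackets with vectors -/

section Iterated

variable {𝕜 V : Type*} [Field 𝕜] [AddCommGroup V] [Module 𝕜 V] [FiniteDimensional 𝕜 V]
  (B : LinearMap.BilinForm 𝕜 V)

theorem iterBracket_zero (a : Fin 0 → V) (x : ExteriorAlgebra 𝕜 V) : iterBracket B a x = x := rfl

theorem iterBracket_succ {n : ℕ} (a : Fin (n + 1) → V) (x : ExteriorAlgebra 𝕜 V) :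
    iterBracket B a x = contractLeft (B (a 0)) (iterBracket B (fun i => a i.succ) x) :=
  poissonBracket_ι_left ..

theorem iterBracket_cons {n : ℕ} (c : V) (a : Fin n → V) (x : ExteriorAlgebra 𝕜 V) :
    iterBracket B (Fin.cons c a : Fin (n + 1) → V) x = contractLeft (B c) (iterBracket B a x) :=
  iterBracket_succ ..

theorem iterBracket_smul {n : ℕ} (a : Fin n → V) (r : 𝕜) (x : ExteriorAlgebra 𝕜 V) :
    iterBracket B a (r • x) = r • iterBracket B a x := by
  induction n with
  | zero => rfl
  | succ n ih => rw [iterBracket_succ, iterBracket_succ, ih, map_smul]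

theorem iterBracket_add {n : ℕ} (a : Fin n → V) (x y : ExteriorAlgebra 𝕜 V) :
    iterBracket B a (x + y) = iterBracket B a x + iterBracket B a y := by
  induction n with
  | zero => rfl
  | succ n ih => rw [iterBracket_succ, iterBracket_succ, iterBracket_succ, ih, map_add]

theorem contractLeft_iterBracket {n : ℕ} (c : V) (a : Fin n → V) (x : ExteriorAlgebra 𝕜 V) :
    contractLeft (B c) (iterBracket B a x) =
      (-1 : 𝕜) ^ n • iterBracket B a (contractLeft (B c) x) := by
  induction n with
  | zero => simp [iterBracket_zero]
  | succ n ih =>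
    rw [iterBracket_succ, iterBracket_succ, CliffordAlgebra.contractLeft_comm, ih, map_smul,
      pow_succ, mul_neg_one, neg_smul]

theorem iterBracket_contractLeft {n : ℕ} (c : V) (a : Fin n → V) (x : ExteriorAlgebra 𝕜 V) :
    iterBracket B a (contractLeft (B c) x) =
      (-1 : 𝕜) ^ n • iterBracket B (Fin.cons c a : Fin (n + 1) → V) x := by
  rw [iterBracket_cons, contractLeft_iterBracket, smul_smul, ← mul_pow]
  simp

theorem iterBracket_mem {n m : ℕ} (a : Fin n → V) {x : ExteriorAlgebra 𝕜 V}
    (hx : x ∈ ⋀[𝕜]^m V) : iterBracket B a x ∈ ⋀[𝕜]^(m - n) V := by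
  induction n with
  | zero => exact hx
  | succ n ih => rw [iterBracket_succ]; exact contractLeft_mem _ (ih _)

variable {B}

theorem eq_zero_of_forall_contractLeft_form_eq_zero [CharZero 𝕜] (hB : B.Nondegenerate) {n : ℕ}
    {w : ExteriorAlgebra 𝕜 V} (hw : w ∈ ⋀[𝕜]^(n + 1) V)
    (h : ∀ c : V, contractLeft (B c) w = 0) : w = 0 :=
  eq_zero_of_forall_contractLeft_eq_zero hw fun d => by
    obtain ⟨c, rfl⟩ := (LinearMap.BilinForm.toDual B hB).surjective d
    exact h c

theorem eq_zero_of_forall_iterBracket_eq_zero [CharZero 𝕜] (hB : B.Nondegenerate) {n : ℕ}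
    {w : ExteriorAlgebra 𝕜 V} (hw : w ∈ ⋀[𝕜]^n V)
    (h : ∀ a : Fin n → V, iterBracket B a w = 0) : w = 0 := by
  induction n generalizing w with
  | zero => exact h Fin.elim0
  | succ n ih =>
    refine eq_zero_of_forall_contractLeft_form_eq_zero hB hw fun c =>
      ih (contractLeft_mem _ hw) fun a => ?_
    have h' := h (Fin.cons c a)
    rw [iterBracket_cons, contractLeft_iterBracket] at h'
    exact (smul_eq_zero.1 h').resolve_left (pow_ne_zero _ (neg_ne_zero.2 one_ne_zero))

/-! ### Elements with prescribed iterated brackets -/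

variable (B) in
/-- The operator `T ↦ (n + 1)⁻¹ ∑ eᵢ ∧ T(eᵢ*)`, with `eᵢ*` the basis dual to `eᵢ` for `B`. It is
the homotopy operator of the Poincaré lemma: applied to `c ↦ B c ⌋ t`, with `t` of degree `n + 1`,
it gives back `t`. -/
noncomputable def radialPrimitive (hB : B.Nondegenerate) (n : ℕ) :
    (V →ₗ[𝕜] ExteriorAlgebra 𝕜 V) →ₗ[𝕜] ExteriorAlgebra 𝕜 V :=
  ((n : 𝕜) + 1)⁻¹ • ∑ i,
    LinearMap.mulLeft 𝕜 (ExteriorAlgebra.ι 𝕜 (Module.finBasis 𝕜 V i)) ∘ₗ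
      LinearMap.applyₗ (LinearMap.BilinForm.dualBasis B hB (Module.finBasis 𝕜 V) i)

theorem radialPrimitive_apply (hB : B.Nondegenerate) (n : ℕ) (T : V →ₗ[𝕜] ExteriorAlgebra 𝕜 V) :
    radialPrimitive B hB n T = ((n : 𝕜) + 1)⁻¹ • ∑ i,
      ExteriorAlgebra.ι 𝕜 (Module.finBasis 𝕜 V i) *
        T (LinearMap.BilinForm.dualBasis B hB (Module.finBasis 𝕜 V) i) := by
  simp [radialPrimitive, LinearMap.sum_apply]

theorem radialPrimitive_mem (hB : B.Nondegenerate) {n : ℕ} {T : V →ₗ[𝕜] ExteriorAlgebra 𝕜 V}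
    (hT : ∀ c, T c ∈ ⋀[𝕜]^n V) : radialPrimitive B hB n T ∈ ⋀[𝕜]^(n + 1) V := by
  rw [radialPrimitive_apply]
  exact Submodule.smul_mem _ _ (Submodule.sum_mem _ fun i _ => ι_mul_mem _ (hT _))

/-- A Poincaré lemma: a linear family `T` of elements of degree `n` is of the form
`c ↦ B c ⌋ t` as soon as it satisfies the antisymmetry that such a family must have. -/
theorem contractLeft_radialPrimitive [CharZero 𝕜] (hB : B.Nondegenerate) {n : ℕ}
    {T : V →ₗ[𝕜] ExteriorAlgebra 𝕜 V} (hT : ∀ c, T c ∈ ⋀[𝕜]^n V)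
    (hanti : ∀ c d, contractLeft (B c) (T d) = -contractLeft (B d) (T c)) (c : V) :
    contractLeft (B c) (radialPrimitive B hB n T) = T c := by
  rw [radialPrimitive_apply, map_smul, map_sum]
  set b := Module.finBasis 𝕜 V
  set u := LinearMap.BilinForm.dualBasis B hB b
  have hu (i) : B (u i) = b.coord i :=
    b.ext fun j => by
      rw [LinearMap.BilinForm.apply_dualBasis_left, Module.Basis.coord_apply,
        Module.Basis.repr_self, Finsupp.single_apply]
  have hc : ∑ i, B c (b i) • u i = c := by
    refine (LinearMap.BilinForm.toDual B hB).injective ?_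
    have h (x) : LinearMap.BilinForm.toDual B hB x = B x := rfl
    rw [h, h, map_sum]
    simp only [map_smul, hu]
    exact b.sum_dual_apply_smul_coord (B c)
  have hn : (n : 𝕜) + 1 ≠ 0 := Nat.cast_add_one_ne_zero n
  have h (i) : contractLeft (B c) (ExteriorAlgebra.ι 𝕜 (b i) * T (u i)) =
      T (B c (b i) • u i) + ExteriorAlgebra.ι 𝕜 (b i) * contractLeft (b.coord i) (T c) := by
    rw [contractLeft_ι_mul, hanti, hu, map_smul, mul_neg, sub_neg_eq_add]
  simp only [h, Finset.sum_add_distrib, ← map_sum, hc,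
    sum_ι_mul_contractLeft_coord b (hT c)]
  rw [inv_smul_eq_iff₀ hn, add_smul, one_smul, add_comm]

/-- Every alternating `n`-form is the iterated bracket with an element of degree `n`, which can
be chosen to depend linearly on the form. -/
theorem exists_linearMap_iterBracket_eq [CharZero 𝕜] (hB : B.Nondegenerate) (n : ℕ) :
    ∃ Φ : (V [⋀^Fin n]→ₗ[𝕜] 𝕜) →ₗ[𝕜] ExteriorAlgebra 𝕜 V, ∀ φ, Φ φ ∈ ⋀[𝕜]^n V ∧
      ∀ a : Fin n → V, iterBracket B a (Φ φ) = algebraMap 𝕜 _ (φ a) := by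
  induction n with
  | zero =>
    refine ⟨Algebra.linearMap 𝕜 _ ∘ₗ
      { toFun := fun φ => φ ![], map_add' := fun _ _ => rfl, map_smul' := fun _ _ => rfl },
      fun φ => ⟨mem_exteriorPower_zero.2 ⟨_, rfl⟩, fun a => ?_⟩⟩
    rw [Subsingleton.elim a ![]]
    rfl
  | succ n ih =>
    obtain ⟨Φ, hΦ⟩ := ih
    -- the sign makes up for the bracket with the first vector being the outermost one
    let F : (V [⋀^Fin (n + 1)]→ₗ[𝕜] 𝕜) →ₗ[𝕜] V →ₗ[𝕜] ExteriorAlgebra 𝕜 V :=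
      (-1 : 𝕜) ^ n • Φ.compRight 𝕜 ∘ₗ AlternatingMap.curryLeftLinearMap
    have hF (φ c) : F φ c = (-1 : 𝕜) ^ n • Φ (φ.curryLeft c) := rfl
    have hmem (φ c) : F φ c ∈ ⋀[𝕜]^n V := Submodule.smul_mem _ _ (hΦ _).1
    have hiter (φ c) (a : Fin n → V) :
        iterBracket B a (F φ c) = (-1 : 𝕜) ^ n • algebraMap 𝕜 _ (φ (Fin.cons c a)) := by
      rw [hF, iterBracket_smul, (hΦ _).2]
      rfl
    have hanti (φ c d) : contractLeft (B c) (F φ d) = -contractLeft (B d) (F φ c) := by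
      cases n with
      | zero =>
        rw [contractLeft_eq_zero_of_mem _ (hmem φ d), contractLeft_eq_zero_of_mem _ (hmem φ c),
          neg_zero]
      | succ n =>
        refine eq_neg_of_add_eq_zero_left (eq_zero_of_forall_iterBracket_eq_zero hB
          (Submodule.add_mem _ (contractLeft_mem _ (hmem φ d))
            (contractLeft_mem _ (hmem φ c))) fun a => ?_)
        have hswap : φ (Fin.cons d (Fin.cons c a)) = -φ (Fin.cons c (Fin.cons d a)) := by
          rw [← φ.map_swap _ (zero_ne_one : (0 : Fin (n + 2)) ≠ 1)]
          congr 1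
          ext i
          refine Fin.cases ?_ (fun i => Fin.cases ?_ (fun i => ?_) i) i
          · simp
          · simp
          · have h1 : i.succ.succ ≠ 0 := Fin.succ_ne_zero _
            have h2 : i.succ.succ ≠ 1 := by simp [Fin.ext_iff]
            simp [Equiv.swap_apply_of_ne_of_ne h1 h2]
        change Fin n → V at a
        rw [iterBracket_add, iterBracket_contractLeft, iterBracket_contractLeft, hiter, hiter, hswap, map_neg]
        simp
    refine ⟨radialPrimitive B hB n ∘ₗ F, fun φ => ⟨radialPrimitive_mem hB (hmem φ), fun a => ?_⟩⟩
    rw [← Fin.cons_self_tail a, iterBracket_cons, contractLeft_iterBracket]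
    rw [LinearMap.comp_apply, contractLeft_radialPrimitive hB (hmem φ) (hanti φ), hiter, smul_smul,
      ← mul_pow]
    simp

/-- An invariant algebra structure `μ` corresponds to an element of the exterior algebra: the form
`(b, μ(a₁, …, aₙ))` is antisymmetric in `b` and `a₁`, hence a Poincaré lemma applies to the family
`c ↦ ±t c`, where `t c` represents the alternating form `(c, μ(a₁, …, aₙ))`. -/
theorem exists_corresponds [CharZero 𝕜] (hB : B.Nondegenerate) {n : ℕ}
    {μ : V [⋀^Fin (n + 1)]→ₗ[𝕜] V} (hμ : IsInvariant B μ) : ∃ t, Corresponds B μ t := by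
  obtain ⟨Φ, hΦ⟩ := exists_linearMap_iterBracket_eq hB (n + 1)
  let T : V →ₗ[𝕜] ExteriorAlgebra 𝕜 V :=
    { toFun := fun c => (-1 : 𝕜) ^ (n + 1) • Φ ((B c).compAlternatingMap μ)
      map_add' := fun c d => by
        rw [← smul_add, ← map_add, map_add B, LinearMap.add_compAlternatingMap]
      map_smul' := fun r c => by
        rw [map_smul B, LinearMap.smul_compAlternatingMap, map_smul, smul_comm]
        rfl }
  have hmem (c) : T c ∈ ⋀[𝕜]^(n + 1) V := Submodule.smul_mem _ _ (hΦ _).1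
  have hiter (c) (a : Fin (n + 1) → V) :
      iterBracket B a (T c) = (-1 : 𝕜) ^ (n + 1) • algebraMap 𝕜 _ (B c (μ a)) := by
    change iterBracket B a ((-1 : 𝕜) ^ (n + 1) • Φ _) = _
    rw [iterBracket_smul, (hΦ _).2]
    rfl
  have hanti (c d) : contractLeft (B c) (T d) = -contractLeft (B d) (T c) := by
    refine eq_neg_of_add_eq_zero_left (eq_zero_of_forall_iterBracket_eq_zero hB
      (Submodule.add_mem _ (contractLeft_mem _ (hmem d)) (contractLeft_mem _ (hmem c)))
      fun a => ?_)
    change Fin n → V at a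
    rw [iterBracket_add, iterBracket_contractLeft, iterBracket_contractLeft, hiter, hiter, hμ c d a, map_neg]
    simp
  refine ⟨radialPrimitive B hB (n + 1) T, radialPrimitive_mem hB hmem, fun a => ?_⟩
  have hm := iterBracket_mem B a (radialPrimitive_mem hB hmem)
  rw [show n + 1 + 1 - (n + 1) = 0 + 1 by omega] at hm
  have hμm : ExteriorAlgebra.ι 𝕜 (μ a) ∈ ⋀[𝕜]^(0 + 1) V := by simp
  refine sub_eq_zero.1 (eq_zero_of_forall_contractLeft_form_eq_zero hB
    (Submodule.sub_mem _ hμm hm) fun c => ?_)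
  have hι : contractLeft (B c) (ExteriorAlgebra.ι 𝕜 (μ a)) =
      algebraMap 𝕜 (ExteriorAlgebra 𝕜 V) (B c (μ a)) :=
    CliffordAlgebra.contractLeft_ι (Q := (0 : QuadraticForm 𝕜 V)) _ _
  rw [map_sub, contractLeft_iterBracket, contractLeft_radialPrimitive hB hmem hanti, hiter,
    smul_smul, ← mul_pow, hι]
  simp

end Iterated

/-! ### Subsets and unshuffles -/

section Unshuffles

/-- The sign of the permutation that lists first the indices in `s`, then the others, both in
increasing order: the product of `-1` over the pairs `j < i` with `i` in `s` and `j` not in `s`.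
A subset of `Fin n` is encoded by its characteristic function. -/
def crossingSign {n : ℕ} (s : Fin n → Bool) : ℤ :=
  ∏ j, ∏ i, if (s j = false ∧ s i = true) ∧ j < i then -1 else 1

theorem crossingSign_cons_true {n : ℕ} (s : Fin n → Bool) :
    crossingSign (Fin.cons true s : Fin (n + 1) → Bool) = crossingSign s := by
  simp [crossingSign, Fin.prod_univ_succ]

theorem crossingSign_cons_false {n : ℕ} (s : Fin n → Bool) :
    crossingSign (Fin.cons false s : Fin (n + 1) → Bool) =
      (-1) ^ Finset.card {i | s i = true} * crossingSign s := by
  simp only [crossingSign, Fin.prod_univ_succ, Fin.cons_zero, Fin.cons_succ, and_false, if_false, one_mul, Fin.succ_pos, and_true, true_and, Fin.succ_lt_succ_iff,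
    not_lt_zero]
  rw [Finset.prod_ite, Finset.prod_const, Finset.prod_const_one, mul_one]

/-- Listing the complement of `s` first, instead of `s`, moves each index in `s` past each index
not in `s`. -/
theorem crossingSign_not {n : ℕ} (s : Fin n → Bool) :
    crossingSign (fun i => !s i) =
      (-1) ^ (Finset.card {i | s i = true} * Finset.card {i | s i = false}) * crossingSign s := by
  have h : (-1 : ℤ) ^ (Finset.card {i | s i = true} * Finset.card {i | s i = false}) =
      ∏ j, ∏ i, if s j = false ∧ s i = true then -1 else 1 := by
    rw [pow_mul, ← Finset.prod_const, Finset.prod_filter]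
    refine Finset.prod_congr rfl fun j _ => ?_
    by_cases hj : s j = false
    · simp only [hj, if_true, true_and]
      rw [← Finset.prod_const, Finset.prod_filter]
    · simp [hj]
  rw [h, crossingSign, crossingSign, Finset.prod_comm, ← Finset.prod_mul_distrib]
  refine Finset.prod_congr rfl fun j _ => ?_
  rw [← Finset.prod_mul_distrib]
  refine Finset.prod_congr rfl fun i _ => ?_
  by_cases hj : s j = false <;> by_cases hi : s i = true
  · have hne : i ≠ j := by rintro rfl; simp_all
    rcases lt_or_gt_of_ne hne with hlt | hlt <;> simp [hj, hi, hlt, not_lt_of_gt hlt]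
  all_goals simp [hj, hi]

/-- The set of the values of a permutation on the first `k` letters. -/
def headSet {k m : ℕ} (σ : Equiv.Perm (Fin (k + m))) (x : Fin (k + m)) : Bool :=
  decide ((σ.symm x : ℕ) < k)

theorem headSet_castAdd {k m : ℕ} (σ : Equiv.Perm (Fin (k + m))) (i : Fin k) :
    headSet σ (σ (Fin.castAdd m i)) = true := by
  simp [headSet]

theorem headSet_natAdd {k m : ℕ} (σ : Equiv.Perm (Fin (k + m))) (j : Fin m) :
    headSet σ (σ (Fin.natAdd k j)) = false := by
  simp [headSet]

theorem headSet_eq_true_iff {k m : ℕ} {σ : Equiv.Perm (Fin (k + m))} {x : Fin (k + m)} :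
    headSet σ x = true ↔ ∃ i : Fin k, σ (Fin.castAdd m i) = x := by
  refine ⟨fun h => ?_, fun ⟨i, hi⟩ => hi ▸ headSet_castAdd σ i⟩
  obtain ⟨y, rfl⟩ := σ.surjective x
  induction y using Fin.addCases with
  | left i => exact ⟨i, rfl⟩
  | right j => simp [headSet_natAdd] at h

theorem headSet_eq_false_iff {k m : ℕ} {σ : Equiv.Perm (Fin (k + m))} {x : Fin (k + m)} :
    headSet σ x = false ↔ ∃ j : Fin m, σ (Fin.natAdd k j) = x := by
  refine ⟨fun h => ?_, fun ⟨j, hj⟩ => hj ▸ headSet_natAdd σ j⟩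
  obtain ⟨y, rfl⟩ := σ.surjective x
  induction y using Fin.addCases with
  | left i => simp [headSet_castAdd] at h
  | right j => exact ⟨j, rfl⟩

theorem card_headSet_eq_true {k m : ℕ} (σ : Equiv.Perm (Fin (k + m))) :
    Finset.card {x | headSet σ x = true} = k := by
  have : ({x | headSet σ x = true} : Finset _) =
      Finset.univ.map ((Fin.castAddEmb m).trans σ.toEmbedding) := by
    ext x; simp [headSet_eq_true_iff]
  rw [this, Finset.card_map, Finset.card_univ, Fintype.card_fin]

theorem card_headSet_eq_false {k m : ℕ} (σ : Equiv.Perm (Fin (k + m))) :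
    Finset.card {x | headSet σ x = false} = m := by
  have : ({x | headSet σ x = false} : Finset _) =
      Finset.univ.map ((Fin.natAddEmb k).trans σ.toEmbedding) := by
    ext x; simp [headSet_eq_false_iff]
  rw [this, Finset.card_map, Finset.card_univ, Fintype.card_fin]

theorem crossingSign_headSet {k m : ℕ} {σ : Equiv.Perm (Fin (k + m))} (hσ : IsUnshuffle σ) :
    crossingSign (headSet σ) = (Equiv.Perm.sign σ : ℤ) := by
  have h1 : (Equiv.Perm.sign σ : ℤ) =
      ∏ j, ∏ i, if i < j ∧ σ j < σ i then (-1 : ℤ) else 1 := by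
    rw [Equiv.Perm.sign_eq_prod_prod_Iio]
    push_cast
    refine Finset.prod_congr rfl fun j _ => ?_
    rw [← Finset.filter_gt_eq_Iio, Finset.prod_filter]
    refine Finset.prod_congr rfl fun i _ => ?_
    by_cases hij : i < j
    · rcases lt_or_gt_of_ne (σ.injective.ne hij.ne) with h | h <;>
        simp [hij, h, not_lt_of_gt h]
    · simp [hij]
  rw [h1, crossingSign, ← Equiv.prod_comp σ]
  refine Finset.prod_congr rfl fun j _ => ?_
  rw [← Equiv.prod_comp σ]
  refine Finset.prod_congr rfl fun i _ => ?_
  refine if_congr ?_ rfl rfl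
  refine and_congr_left fun hlt => ?_
  induction j using Fin.addCases with
  | left j =>
    induction i using Fin.addCases with
    | left i =>
      have := hσ.1.lt_iff_lt.1 hlt
      have hle : Fin.castAdd m j ≤ Fin.castAdd m i := Fin.le_def.2 this.le
      simpa [headSet_castAdd] using hle
    | right i => simp [headSet_castAdd, Fin.lt_def]; omega
  | right j =>
    induction i using Fin.addCases with
    | left i => simp [headSet_castAdd, headSet_natAdd, Fin.lt_def]; omega
    | right i =>
      have := hσ.2.lt_iff_lt.1 hlt
      simp [headSet_natAdd, this.le]

theorem IsUnshuffle.eq_of_headSet_eq {k m : ℕ} {σ τ : Equiv.Perm (Fin (k + m))}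
    (hσ : IsUnshuffle σ) (hτ : IsUnshuffle τ) (h : headSet σ = headSet τ) : σ = τ := by
  have h1 : (fun i : Fin k => σ (Fin.castAdd m i)) = fun i => τ (Fin.castAdd m i) := by
    refine (hσ.1.range_inj hτ.1).1 (Set.ext fun x => ?_)
    exact headSet_eq_true_iff.symm.trans (h ▸ headSet_eq_true_iff)
  have h2 : (fun j : Fin m => σ (Fin.natAdd k j)) = fun j => τ (Fin.natAdd k j) := by
    refine (hσ.2.range_inj hτ.2).1 (Set.ext fun x => ?_)
    exact headSet_eq_false_iff.symm.trans (h ▸ headSet_eq_false_iff)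
  ext x
  induction x using Fin.addCases with
  | left i => exact congrArg Fin.val (congrFun h1 i)
  | right j => exact congrArg Fin.val (congrFun h2 j)

theorem exists_isUnshuffle_headSet_eq {k m : ℕ} {s : Fin (k + m) → Bool}
    (hs : Finset.card {i | s i = true} = k) :
    ∃ σ : Equiv.Perm (Fin (k + m)), IsUnshuffle σ ∧ headSet σ = s := by
  have hs' : Finset.card ({i | s i = true} : Finset (Fin (k + m)))ᶜ = m := by
    rw [Finset.card_compl, hs, Fintype.card_fin, Nat.add_sub_cancel_left]
  let σ : Equiv.Perm (Fin (k + m)) := finSumFinEquiv.symm.trans (finSumEquivOfFinset hs hs')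
  have h1 (i : Fin k) : σ (Fin.castAdd m i) = Finset.orderEmbOfFin _ hs i := by simp [σ]
  have h2 (j : Fin m) : σ (Fin.natAdd k j) = Finset.orderEmbOfFin _ hs' j := by simp [σ]
  refine ⟨σ, ⟨?_, ?_⟩, funext fun x => ?_⟩
  · simpa only [h1] using (Finset.orderEmbOfFin _ hs).strictMono
  · simpa only [h2] using (Finset.orderEmbOfFin _ hs').strictMono
  · obtain ⟨y, rfl⟩ := σ.surjective x
    induction y using Fin.addCases with
    | left i =>
      have := Finset.orderEmbOfFin_mem _ hs i
      rw [headSet_castAdd, h1]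
      exact (by simpa only [Finset.mem_compl, Finset.mem_filter, Finset.mem_univ, true_and,
        Bool.not_eq_true] using this : s _ = _).symm
    | right j =>
      have := Finset.orderEmbOfFin_mem _ hs' j
      rw [headSet_natAdd, h2]
      exact (by simpa only [Finset.mem_compl, Finset.mem_filter, Finset.mem_univ, true_and,
        Bool.not_eq_true] using this : s _ = _).symm

open Classical in
theorem sum_isUnshuffle_headSet {M : Type*} [AddCommMonoid M] {k m : ℕ}
    (F : (Fin (k + m) → Bool) → M) :
    ∑ σ : Equiv.Perm (Fin (k + m)) with IsUnshuffle σ, F (headSet σ) =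
      ∑ s : Fin (k + m) → Bool with Finset.card {i | s i = true} = k, F s := by
  refine Finset.sum_bij (fun σ _ => headSet σ) (fun σ _ => ?_) (fun σ hσ τ hτ h => ?_)
    (fun s hs => ?_) fun _ _ => rfl
  · simp [card_headSet_eq_true]
  · exact IsUnshuffle.eq_of_headSet_eq (by simpa using hσ) (by simpa using hτ) h
  · obtain ⟨σ, hσ, rfl⟩ := exists_isUnshuffle_headSet_eq (Finset.mem_filter.1 hs).2
    exact ⟨σ, by simpa using hσ, rfl⟩

end Unshuffles

/-! ### The Leibniz expansion of an iterated bracket -/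

section Expansion

variable {𝕜 V : Type*} [Field 𝕜] [AddCommGroup V] [Module 𝕜 V] (B : LinearMap.BilinForm 𝕜 V)

theorem involute_contractLeft (d : Module.Dual 𝕜 V) (x : ExteriorAlgebra 𝕜 V) :
    involute (contractLeft d x) = -contractLeft d (involute x) := by
  rw [contractLeft_involute, neg_neg]

/-- The iterated bracket of `x` with those vectors `a i` whose index lies in `s`. -/
noncomputable def selectBracket {n : ℕ} (a : Fin n → V) (s : Fin n → Bool)
    (x : ExteriorAlgebra 𝕜 V) : ExteriorAlgebra 𝕜 V :=
  ((List.finRange n).filter s).foldr (fun i y => contractLeft (B (a i)) y) x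

theorem selectBracket_zero (a : Fin 0 → V) (s : Fin 0 → Bool) (x : ExteriorAlgebra 𝕜 V) :
    selectBracket B a s x = x := rfl

theorem selectBracket_cons_true {n : ℕ} (a : Fin (n + 1) → V) (s : Fin n → Bool)
    (x : ExteriorAlgebra 𝕜 V) :
    selectBracket B a (Fin.cons true s : Fin (n + 1) → Bool) x =
      contractLeft (B (a 0)) (selectBracket B (fun i => a i.succ) s x) := by
  simp [selectBracket, List.finRange_succ, List.filter_map, List.foldr_map, Function.comp_def]

theorem selectBracket_cons_false {n : ℕ} (a : Fin (n + 1) → V) (s : Fin n → Bool)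
    (x : ExteriorAlgebra 𝕜 V) :
    selectBracket B a (Fin.cons false s : Fin (n + 1) → Bool) x =
      selectBracket B (fun i => a i.succ) s x := by
  simp [selectBracket, List.finRange_succ, List.filter_map, List.foldr_map, Function.comp_def]

theorem selectBracket_mem {n m : ℕ} (a : Fin n → V) (s : Fin n → Bool) {x : ExteriorAlgebra 𝕜 V}
    (hx : x ∈ ⋀[𝕜]^m V) :
    selectBracket B a s x ∈ ⋀[𝕜]^(m - Finset.card {i | s i = true}) V := by
  induction n with
  | zero => exact hx
  | succ n ih =>
    rw [Fin.card_filter_univ_succ', ← Fin.cons_self_tail s]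
    have := ih (fun i => a i.succ) (Fin.tail s)
    cases s 0 with
    | true =>
      rw [selectBracket_cons_true, add_comm, Fin.cons_zero, if_pos rfl, ← Nat.sub_sub]
      exact contractLeft_mem _ this
    | false =>
      rw [selectBracket_cons_false, Fin.cons_zero, if_neg Bool.false_ne_true, zero_add]
      exact this

theorem involute_selectBracket {n d : ℕ} (a : Fin n → V) (s : Fin n → Bool)
    {x : ExteriorAlgebra 𝕜 V} (hx : involute x = (-1 : ℤ) ^ d • x) :
    involute (selectBracket B a s x) =
      ((-1 : ℤ) ^ d * (-1) ^ Finset.card {i | s i = true}) • selectBracket B a s x := by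
  induction n with
  | zero => simpa [selectBracket_zero] using hx
  | succ n ih =>
    rw [Fin.card_filter_univ_succ', ← Fin.cons_self_tail s]
    have := ih (fun i => a i.succ) (Fin.tail s)
    cases s 0 with
    | true =>
      rw [selectBracket_cons_true, involute_contractLeft, this, Fin.cons_zero, if_pos rfl, map_zsmul, pow_add,
        pow_one, neg_one_mul, mul_neg, neg_smul]
      rfl
    | false =>
      rw [selectBracket_cons_false, Fin.cons_zero, if_neg Bool.false_ne_true, zero_add]
      exact this

open Classical in
theorem ι_insertion {k m : ℕ} (F : V [⋀^Fin (m + 1)]→ₗ[𝕜] V) (G : V [⋀^Fin k]→ₗ[𝕜] V)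
    (a : Fin (k + m) → V) :
    ExteriorAlgebra.ι 𝕜 (insertion F G a) =
      ∑ σ : Equiv.Perm (Fin (k + m)) with IsUnshuffle σ, (Equiv.Perm.sign σ : ℤ) •
        ExteriorAlgebra.ι 𝕜 (F (Fin.cons (G fun i => a (σ (Fin.castAdd m i)))
          fun j => a (σ (Fin.natAdd k j)))) := by
  rw [insertion, map_sum]
  exact Finset.sum_congr rfl fun σ _ => map_zsmul _ _ _

variable [FiniteDimensional 𝕜 V]

theorem iterBracket_eq_foldr {n : ℕ} (a : Fin n → V) (x : ExteriorAlgebra 𝕜 V) :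
    iterBracket B a x = (List.ofFn a).foldr (fun c y => contractLeft (B c) y) x := by
  induction n with
  | zero => rw [List.ofFn_zero]; rfl
  | succ n ih => rw [iterBracket_succ, ih, List.ofFn_succ, List.foldr_cons]

theorem selectBracket_eq_iterBracket {n k : ℕ} (a : Fin n → V) {s : Fin n → Bool}
    {e : Fin k → Fin n} (he : StrictMono e) (hs : ∀ x, s x = true ↔ ∃ i, e i = x)
    (x : ExteriorAlgebra 𝕜 V) : selectBracket B a s x = iterBracket B (fun i => a (e i)) x := by
  have h : (List.finRange n).filter s = List.ofFn e := by
    refine List.SortedLT.eq_of_mem_iff ?_ ?_ fun x => ?_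
    · exact ((List.sortedLT_finRange n).pairwise.filter s).sortedLT
    · exact he.sortedLT_ofFn
    · simp [hs, List.mem_ofFn]
  rw [selectBracket, h, iterBracket_eq_foldr, ← Function.comp_def a e, ← List.map_ofFn,
    List.foldr_map]

/-- The Jacobi identity with a vector: bracketing with it is an odd derivation of the bracket. -/
theorem contractLeft_poissonBracket (c : V) (v w : ExteriorAlgebra 𝕜 V) :
    contractLeft (B c) (poissonBracket B v w) =
      poissonBracket B (contractLeft (B c) v) w +
        poissonBracket B (involute v) (contractLeft (B c) w) := by
  simp only [poissonBracket_apply, map_sum, ← Finset.sum_add_distrib]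
  refine Finset.sum_congr rfl fun i _ => ?_
  rw [contractLeft_mul, contractLeft_involute, contractLeft_involute (d := Module.Basis.coord _ i),
    CliffordAlgebra.contractLeft_comm (d := B c), CliffordAlgebra.contractLeft_comm (d := B c),
    map_neg, map_neg, neg_neg, neg_mul, mul_neg]

/-- The Leibniz rule for the iterated bracket: each vector is bracketed with one of the two
factors, and the sum is over the set `s` of the indices of those that go to the first one. -/
theorem iterBracket_poissonBracket {n d : ℕ} (a : Fin n → V) {v : ExteriorAlgebra 𝕜 V}
    (hv : involute v = (-1 : ℤ) ^ d • v) (w : ExteriorAlgebra 𝕜 V) :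
    iterBracket B a (poissonBracket B v w) = ∑ s : Fin n → Bool,
      ((-1 : ℤ) ^ (d * Finset.card {i | s i = false}) * crossingSign s) •
        poissonBracket B (selectBracket B a s v) (selectBracket B a (fun i => !s i) w) := by
  induction n with
  | zero => simp [iterBracket_zero, selectBracket_zero, crossingSign]
  | succ n ih =>
    have hnot (b : Bool) (s : Fin n → Bool) :
        (fun i => !(Fin.cons b s : Fin (n + 1) → Bool) i) = Fin.cons (!b) fun i => !s i := by
      ext i; refine Fin.cases ?_ (fun i => ?_) i <;> simp
    rw [iterBracket_succ, ih, ← (Fin.consEquiv fun _ => Bool).sum_comp, Fintype.sum_prod_type,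
      Fintype.sum_bool, map_sum, ← Finset.sum_add_distrib]
    refine Finset.sum_congr rfl fun s _ => ?_
    have hcard (b : Bool) : Finset.card {i | (Fin.cons b s : Fin (n + 1) → Bool) i = false} =
        (if b = false then 1 else 0) + Finset.card {i | s i = false} := by
      simp only [Fin.card_filter_univ_succ', Fin.cons_zero, Fin.cons_succ]
    change _ = ((-1 : ℤ) ^ (d * Finset.card
        {i | (Fin.cons true s : Fin (n + 1) → Bool) i = false}) *
          crossingSign (Fin.cons true s : Fin (n + 1) → Bool)) •
      poissonBracket B (selectBracket B a (Fin.cons true s : Fin (n + 1) → Bool) v)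
        (selectBracket B a (fun i => !(Fin.cons true s : Fin (n + 1) → Bool) i) w) +
      ((-1 : ℤ) ^ (d * Finset.card
        {i | (Fin.cons false s : Fin (n + 1) → Bool) i = false}) *
          crossingSign (Fin.cons false s : Fin (n + 1) → Bool)) •
      poissonBracket B (selectBracket B a (Fin.cons false s : Fin (n + 1) → Bool) v)
        (selectBracket B a (fun i => !(Fin.cons false s : Fin (n + 1) → Bool) i) w)
    rw [hcard, hcard, hnot, hnot, Bool.not_true, Bool.not_false, selectBracket_cons_true,
      selectBracket_cons_false, selectBracket_cons_true, selectBracket_cons_false,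
      crossingSign_cons_true, crossingSign_cons_false, map_zsmul, contractLeft_poissonBracket,
      involute_selectBracket B _ _ hv, map_zsmul, LinearMap.smul_apply, smul_add, smul_smul]
    congr 2
    · simp
    · rw [if_pos rfl, mul_add, pow_add, mul_one]
      ring

theorem poissonBracket_eq_zero_of_mem_left {v : ExteriorAlgebra 𝕜 V} (hv : v ∈ ⋀[𝕜]^0 V)
    (w : ExteriorAlgebra 𝕜 V) : poissonBracket B v w = 0 := by
  obtain ⟨r, rfl⟩ := mem_exteriorPower_zero.1 hv
  exact poissonBracket_algebraMap_left B r w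

theorem poissonBracket_eq_zero_of_mem_right {w : ExteriorAlgebra 𝕜 V} (hw : w ∈ ⋀[𝕜]^0 V)
    (v : ExteriorAlgebra 𝕜 V) : poissonBracket B v w = 0 := by
  rw [poissonBracket_apply]
  exact Finset.sum_eq_zero fun i _ => by rw [contractLeft_eq_zero_of_mem _ hw, mul_zero]

open Classical in
/-- The terms of the Leibniz expansion in which `k` vectors go to the first factor, as a sum over
unshuffles. -/
theorem sum_card_eq_left {n k m d : ℕ} (h : k + m = n) (a : Fin n → V)
    (v w : ExteriorAlgebra 𝕜 V) :
    (∑ s : Fin n → Bool with Finset.card {i | s i = true} = k,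
      ((-1 : ℤ) ^ (d * Finset.card {i | s i = false}) * crossingSign s) •
        poissonBracket B (selectBracket B a s v) (selectBracket B a (fun i => !s i) w)) =
    (-1 : ℤ) ^ (d * m) • ∑ σ : Equiv.Perm (Fin (k + m)) with IsUnshuffle σ,
      (Equiv.Perm.sign σ : ℤ) • poissonBracket B
        (iterBracket B (fun i => a (Fin.cast h (σ (Fin.castAdd m i)))) v)
        (iterBracket B (fun j => a (Fin.cast h (σ (Fin.natAdd k j)))) w) := by
  subst h
  rw [← sum_isUnshuffle_headSet, Finset.smul_sum]
  refine Finset.sum_congr rfl fun σ hσ => ?_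
  have hσ' : IsUnshuffle σ := by simpa using hσ
  rw [card_headSet_eq_false, crossingSign_headSet hσ', mul_smul,
    selectBracket_eq_iterBracket B a hσ'.1 fun x => headSet_eq_true_iff,
    selectBracket_eq_iterBracket B a hσ'.2 fun x => by
      rw [Bool.not_eq_true', headSet_eq_false_iff]]
  rfl

open Classical in
/-- The terms of the Leibniz expansion in which `k` vectors go to the second factor, as a sum over
unshuffles that list these vectors first. -/
theorem sum_card_eq_right {n k m d : ℕ} (h : k + m = n) (a : Fin n → V)
    (v w : ExteriorAlgebra 𝕜 V) :
    (∑ s : Fin n → Bool with Finset.card {i | s i = false} = k,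
      ((-1 : ℤ) ^ (d * Finset.card {i | s i = false}) * crossingSign s) •
        poissonBracket B (selectBracket B a s v) (selectBracket B a (fun i => !s i) w)) =
    (-1 : ℤ) ^ (d * k + k * m) • ∑ σ : Equiv.Perm (Fin (k + m)) with IsUnshuffle σ,
      (Equiv.Perm.sign σ : ℤ) • poissonBracket B
        (iterBracket B (fun j => a (Fin.cast h (σ (Fin.natAdd k j)))) v)
        (iterBracket B (fun i => a (Fin.cast h (σ (Fin.castAdd m i)))) w) := by
  subst h
  have hinv : Function.Involutive fun (s : Fin (k + m) → Bool) i => !s i :=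
    fun s => by simp
  have hcompl : (∑ s : Fin (k + m) → Bool with Finset.card {i | s i = false} = k,
      ((-1 : ℤ) ^ (d * Finset.card {i | s i = false}) * crossingSign s) •
        poissonBracket B (selectBracket B a s v) (selectBracket B a (fun i => !s i) w)) =
      ∑ s : Fin (k + m) → Bool with Finset.card {i | s i = true} = k,
      ((-1 : ℤ) ^ (d * Finset.card {i | s i = true}) * crossingSign fun i => !s i) •
        poissonBracket B (selectBracket B a (fun i => !s i) v) (selectBracket B a s w) := by
    simp only [Finset.sum_filter]
    rw [← Equiv.sum_comp hinv.toPerm]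
    simp
  rw [hcompl, ← sum_isUnshuffle_headSet, Finset.smul_sum]
  refine Finset.sum_congr rfl fun σ hσ => ?_
  have hσ' : IsUnshuffle σ := by simpa using hσ
  rw [crossingSign_not, card_headSet_eq_false, card_headSet_eq_true, crossingSign_headSet hσ',
    ← mul_assoc, ← pow_add, mul_smul,
    selectBracket_eq_iterBracket B a hσ'.1 fun x => headSet_eq_true_iff,
    selectBracket_eq_iterBracket B a hσ'.2 fun x => by
      rw [Bool.not_eq_true', headSet_eq_false_iff]]
  rfl

variable {B}

open Classical in
/-- The two families of terms left in the expansion of `iterBracket B a [v, w]`, `v` and `w` of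
degrees `p + 2` and `q + 2`, for reasons of degree: as scalars have zero bracket, either `p + 1`
vectors go to `v` and `q` to `w`, or `p` to `v` and `q + 1` to `w`. -/
theorem iterBracket_poissonBracket_eq_add {p q : ℕ} (a : Fin (p + q + 1) → V)
    {v w : ExteriorAlgebra 𝕜 V} (hv : v ∈ ⋀[𝕜]^(p + 2) V) (hw : w ∈ ⋀[𝕜]^(q + 2) V)
    (h1 : p + 1 + q = p + q + 1) (h2 : q + 1 + p = p + q + 1) :
    iterBracket B a (poissonBracket B v w) =
      (-1 : ℤ) ^ (p * q) • (∑ σ : Equiv.Perm (Fin (p + 1 + q)) with IsUnshuffle σ,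
        (Equiv.Perm.sign σ : ℤ) • poissonBracket B
          (iterBracket B (fun i => a (Fin.cast h1 (σ (Fin.castAdd q i)))) v)
          (iterBracket B (fun j => a (Fin.cast h1 (σ (Fin.natAdd (p + 1) j)))) w)) +
      ∑ σ : Equiv.Perm (Fin (q + 1 + p)) with IsUnshuffle σ,
        (Equiv.Perm.sign σ : ℤ) • poissonBracket B
          (iterBracket B (fun j => a (Fin.cast h2 (σ (Fin.natAdd (q + 1) j)))) v)
          (iterBracket B (fun i => a (Fin.cast h2 (σ (Fin.castAdd p i)))) w) := by
  have hcard (s : Fin (p + q + 1) → Bool) :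
      Finset.card {i | s i = true} + Finset.card {i | s i = false} = p + q + 1 := by
    simpa using Finset.card_filter_add_card_filter_not (s := Finset.univ) fun i => s i = true
  have e1 : (-1 : ℤ) ^ (p * q) = (-1) ^ ((p + 2) * q) := by
    rw [neg_one_pow_congr]; grind
  have e2 : (-1 : ℤ) ^ ((p + 2) * (q + 1) + (q + 1) * p) = 1 := by
    apply Even.neg_one_pow; grind
  have hleft := sum_card_eq_left (d := p + 2) B h1 a v w
  have hright := sum_card_eq_right (d := p + 2) B h2 a v w
  rw [e2, one_smul] at hright
  rw [e1, ← hleft, ← hright, iterBracket_poissonBracket B a (involute_of_mem hv),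
    Finset.sum_filter, Finset.sum_filter, ← Finset.sum_add_distrib]
  refine Finset.sum_congr rfl fun s _ => ?_
  have hs := hcard s
  have hvs := selectBracket_mem B a s hv
  have hws := selectBracket_mem B a (fun i => !s i) hw
  simp only [Bool.not_eq_true'] at hws
  by_cases c1 : Finset.card {i | s i = true} = p + 1
  · rw [if_pos c1, if_neg (by omega), add_zero]
  · by_cases c2 : Finset.card {i | s i = false} = q + 1
    · rw [if_neg c1, if_pos c2, zero_add]
    · rw [if_neg c1, if_neg c2, add_zero]
      rcases Nat.lt_or_gt_of_ne c1 with hlt | hlt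
      · rw [show q + 2 - Finset.card {i | s i = false} = 0 by omega] at hws
        rw [poissonBracket_eq_zero_of_mem_right B hws, smul_zero]
      · rw [show p + 2 - Finset.card {i | s i = true} = 0 by omega] at hvs
        rw [poissonBracket_eq_zero_of_mem_left B hvs, smul_zero]

theorem Corresponds.poissonBracket_ι {n : ℕ} {μ : V [⋀^Fin (n + 1)]→ₗ[𝕜] V}
    {t : ExteriorAlgebra 𝕜 V} (h : Corresponds B μ t) (x : V) (a : Fin n → V) :
    poissonBracket B (ExteriorAlgebra.ι 𝕜 x) (iterBracket B a t) =
      ExteriorAlgebra.ι 𝕜 (μ (Fin.cons x a)) := by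
  rw [h.2, iterBracket_cons, poissonBracket_ι_left]

theorem Corresponds.poissonBracket_ι_right (hB : B.IsSymm) {n : ℕ}
    {μ : V [⋀^Fin (n + 1)]→ₗ[𝕜] V} {t : ExteriorAlgebra 𝕜 V} (h : Corresponds B μ t) (x : V)
    (a : Fin n → V) :
    poissonBracket B (iterBracket B a t) (ExteriorAlgebra.ι 𝕜 x) =
      -ExteriorAlgebra.ι 𝕜 (μ (Fin.cons x a)) := by
  have ht := iterBracket_mem B a h.1
  rw [show n + 1 + 1 - n = 2 by omega] at ht
  have hx : ExteriorAlgebra.ι 𝕜 x ∈ ⋀[𝕜]^1 V := by simp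
  rw [poissonBracket_skew B hB ht hx, h.poissonBracket_ι]
  simp

theorem iterBracket_poissonBracket_of_corresponds (hB : B.IsSymm) {p q : ℕ}
    {L : V [⋀^Fin (p + 1)]→ₗ[𝕜] V} {K : V [⋀^Fin (q + 1)]→ₗ[𝕜] V} {Lt Kt : ExteriorAlgebra 𝕜 V}
    (hL : Corresponds B L Lt) (hK : Corresponds B K Kt) (a : Fin (p + q + 1) → V) :
    iterBracket B a (poissonBracket B Lt Kt) = ExteriorAlgebra.ι 𝕜
      (-((-1 : ℤ) ^ ((q + 1 + 1) * (p + 1 + 1)) • nrBracket L K a)) := by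
  have h1 : p + 1 + q = p + q + 1 := by omega
  have h2 : q + 1 + p = p + q + 1 := by omega
  have e : (-1 : ℤ) ^ ((q + 1 + 1) * (p + 1 + 1)) = (-1) ^ (p * q) := by
    rw [neg_one_pow_congr]; grind
  rw [iterBracket_poissonBracket_eq_add a hL.1 hK.1 h1 h2]
  simp only [← hL.2, ← hK.2, hK.poissonBracket_ι, hL.poissonBracket_ι_right hB, smul_neg,
    Finset.sum_neg_distrib]
  rw [e, nrBracket, smul_sub, smul_smul, ← mul_pow, neg_mul_neg, mul_one, one_pow, one_smul,
    neg_sub, map_sub, map_zsmul, ι_insertion, ι_insertion, sub_eq_add_neg]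

end Expansion

end PoissonNR

theorem mainTheorem3 {𝕜 V : Type*} [RCLike 𝕜] [AddCommGroup V] [Module 𝕜 V]
    [FiniteDimensional 𝕜 V] (B : LinearMap.BilinForm 𝕜 V) (hsymm : B.IsSymm)
    (hnondeg : B.Nondegenerate) {p q : ℕ}
    (L : V [⋀^Fin (p + 1)]→ₗ[𝕜] V) (K : V [⋀^Fin (q + 1)]→ₗ[𝕜] V)
    (hL : PoissonNR.IsInvariant B L) (hK : PoissonNR.IsInvariant B K) :
    (∃ Lt, PoissonNR.Corresponds B L Lt) ∧ (∃ Kt, PoissonNR.Corresponds B K Kt) ∧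
    ∀ Lt Kt : ExteriorAlgebra 𝕜 V,
      PoissonNR.Corresponds B L Lt → PoissonNR.Corresponds B K Kt →
      ∀ a : Fin (p + q + 1) → V,
        PoissonNR.iterBracket B a (PoissonNR.poissonBracket B Lt Kt) =
          ExteriorAlgebra.ι 𝕜 (-((-1 : ℤ) ^ ((q + 1 + 1) * (p + 1 + 1)) • PoissonNR.nrBracket L K a)) := by
  exact ⟨PoissonNR.exists_corresponds hnondeg hL, PoissonNR.exists_corresponds hnondeg hK,
    fun _ _ hLt hKt a => PoissonNR.iterBracket_poissonBracket_of_corresponds hsymm hLt hKt a⟩
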